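/- Let $n\ge 1$, let $A$ be a real $n\times n$ matrix that is diagonalizable over $\mathbb R$ with positive eigenvalues, and let $\alpha>0$. Let $H:\mathbb R^n\setminus\{0\}\to\mathbb R$ be positively homogeneous of degree $\alpha$ (that is, $H(sx)=s^\alpha H(x)$ for all $x\neq 0$ and $s>0$), and positive and continuous on the unit sphere $\mathbb S^{n-1}$. Let $0\le t_0<T_*$ be real numbers, and let $y\in C^1([t_0,T_*),\mathbb R^n)$ satisfy $y(t)\ne 0$ for all $t\in[t_0,T_*)$, $\lim_{t\to T_*^-}|y(t)|=\infty$, and $$y'(t)=H(y(t))\,Ay(t)+f(t)\quad\text{for } t\in(t_0,T_*),$$ where $f:[t_0,T_*)\to\mathbb R^n$ is continuous and $$|f(t)|\le |y(t)|^{1+\alpha}E_0(t)\quad\text{for all } t\in[t_0,T_*)$$ with some integrable function $E_0:[t_0,T_*)\to[0,\infty)$. Assume that $H$ has property (HC) on $\mathbb S^{n-1}$ with one power $\gamma\in(0,1]$ for all points: for every $x_0\in\mathbb S^{n-1}$ there are numbers $r,C>0$ such that $|H(x)-H(x_0)|\le C|x-x_0|^\gamma$ for all $x\in\mathbb S^{n-1}$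 with $|x-x_0|<r$. Assume also that $$E_0(t)=\frac{M}{|\ln(T_*-t)|^{p}}\quad\text{for all } t\in[t_0,T_*) \text{ sufficiently close to } T_*,$$ where $M>0$ and $p>1+1/\gamma$. Then $p_*=\gamma(p-1)-1>0$, and there exists an eigenvector $\xi_*$ of $A$, associated with an eigenvalue $\Lambda$, such that $\alpha\Lambda H(\xi_*)=1$ and $$\left|(T_*-t)^{1/\alpha}y(t)-\xi_*\right|=\mathcal O\left(|\ln(T_*-t)|^{-p_*}\right)\quad\text{as } t\to T_*^-.$$ -/

import Mathlib

open Set Filter Topology Asymptotics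

/-- `F` is positively homogeneous of degree `β` on `X ∖ {0}`. The value of `F` at `0` is
irrelevant: a function on `X ∖ {0}` is represented by any extension of it to `X`. -/
def PosHomogeneous {X Y : Type*} [AddCommGroup X] [Module ℝ X] [AddCommGroup Y] [Module ℝ Y]
    (β : ℝ) (F : X → Y) : Prop :=
  ∀ x : X, x ≠ 0 → ∀ t : ℝ, 0 < t → F (t • x) = t ^ β • F x

/-- The real matrix `A` is diagonalizable over `ℝ` and all its eigenvalues are positive:
`A = S⁻¹ diag(Λ₁, …, Λₙ) S` with `S` real and invertible and every `Λᵢ > 0`. -/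
def DiagonalizablePosEigenvalues {n : ℕ} (A : Matrix (Fin n) (Fin n) ℝ) : Prop :=
  ∃ (S : Matrix (Fin n) (Fin n) ℝ) (Λ : Fin n → ℝ),
    IsUnit S ∧ (∀ i, 0 < Λ i) ∧ A = S⁻¹ * Matrix.diagonal Λ * S

/-- Property (HC) of `F` on `E` with one and the same power `γ` at all points of `E`: the radius
`r` and the constant `C` may depend on the point `x₀`. -/
def HasPropertyHCWith {n : ℕ} (γ : ℝ) (F : EuclideanSpace ℝ (Fin n) → ℝ)
    (E : Set (EuclideanSpace ℝ (Fin n))) : Prop :=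
  ∀ x₀ ∈ E, ∃ r C : ℝ, 0 < r ∧ 0 < C ∧
    ∀ x ∈ E, ‖x - x₀‖ < r → |F x - F x₀| ≤ C * ‖x - x₀‖ ^ γ

/-- `y ∈ C¹([t₀, T), ℝⁿ)` never vanishes, satisfies `|y(t)| → ∞` as `t → T⁻`, and solves
`y' = H(y) A y + f(t)` on `(t₀, T)`. -/
structure IsBlowupSolution {n : ℕ} (A : Matrix (Fin n) (Fin n) ℝ)
    (H : EuclideanSpace ℝ (Fin n) → ℝ) (f : ℝ → EuclideanSpace ℝ (Fin n)) (t₀ T : ℝ)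
    (y : ℝ → EuclideanSpace ℝ (Fin n)) : Prop where
  contDiffOn : ContDiffOn ℝ 1 y (Ico t₀ T)
  ne_zero : ∀ t ∈ Ico t₀ T, y t ≠ 0
  tendsto_norm : Tendsto (fun t => ‖y t‖) (𝓝[<] T) atTop
  hasDerivAt : ∀ t ∈ Ioo t₀ T,
    HasDerivAt y (H (y t) • Matrix.toEuclideanLin A (y t) + f t) t

/-! Put `s = -ln (T - t)` and let `z` be `y` in coordinates that diagonalize `A`. Then `z' = e^{-s}
(H Λ z + F)`, where `|F|` is at most a constant times `|z|^(1+α) s^(-p)`. Norm and direction are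
treated separately.

The function `ρ = |z|^(-α)` satisfies `ρ' = -e^{-s} k`, where `k` depends only on the direction up
to `O(s^(-p))` and lies between two positive constants. Since `ρ → 0`, `ρ` is comparable to
`e^{-s}`. The direction `v = z/|z|` therefore solves `v_i' = g (Λ_i - λ) v_i + O(s^(-p))`, with `λ =
∑ Λ_j v_j²` and `g` between positive constants: a perturbed gradient flow on the sphere.

Along it `λ` increases up to an integrable error, so `λ → μ`. Components with `Λ_i ≠ μ` are
hyperbolic and hence `O(s^(-p))`, which forces `λ - μ = O(s^(-p))`. The other components then have
derivative `O(s^(-p))` and converge at rate `s^(-(p-1))` (`exists_direction_limit`). Hölder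
continuity turns this into the rate `s^(-γ(p-1))` for `k`, integration from infinity carries it to
`e^s ρ` (`exp_mul_sub_isBigO`), and `isBigO_exp_smul_sub` recombines norm and direction. The
exponent reached is `p_* + 1`. -/

/-! ### Scalar differential inequalities at infinity -/

theorem exists_monotoneOn_Ici_of_eventually_hasDerivAt {φ φ' : ℝ → ℝ}
    (hd : ∀ᶠ s in atTop, HasDerivAt φ (φ' s) s) (hn : ∀ᶠ s in atTop, 0 ≤ φ' s) :
    ∃ a, MonotoneOn φ (Ici a) := by
  obtain ⟨a, ha⟩ := eventually_atTop.1 (hd.and hn)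
  refine ⟨a, monotoneOn_of_deriv_nonneg (convex_Ici a)
    (fun s hs => (ha s hs).1.continuousAt.continuousWithinAt) (fun s hs => ?_) fun s hs => ?_⟩
  · exact (ha s (interior_subset hs)).1.differentiableAt.differentiableWithinAt
  · rw [(ha s (interior_subset hs)).1.deriv]
    exact (ha s (interior_subset hs)).2

theorem eventually_le_of_eventually_deriv_nonneg {φ φ' : ℝ → ℝ} {l : ℝ}
    (hd : ∀ᶠ s in atTop, HasDerivAt φ (φ' s) s) (hn : ∀ᶠ s in atTop, 0 ≤ φ' s)
    (hl : Tendsto φ atTop (𝓝 l)) : ∀ᶠ s in atTop, φ s ≤ l := by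
  obtain ⟨a, ha⟩ := exists_monotoneOn_Ici_of_eventually_hasDerivAt hd hn
  filter_upwards [eventually_ge_atTop a] with s hs
  refine ge_of_tendsto hl ?_
  filter_upwards [eventually_ge_atTop s] with u hu
  exact ha hs (hs.trans hu) hu

theorem exists_tendsto_of_eventually_deriv_nonneg {φ φ' : ℝ → ℝ} {B : ℝ}
    (hd : ∀ᶠ s in atTop, HasDerivAt φ (φ' s) s) (hn : ∀ᶠ s in atTop, 0 ≤ φ' s)
    (hB : ∀ᶠ s in atTop, φ s ≤ B) : ∃ l, Tendsto φ atTop (𝓝 l) := by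
  obtain ⟨a, ha⟩ := exists_monotoneOn_Ici_of_eventually_hasDerivAt hd hn
  obtain ⟨b, hb⟩ := eventually_atTop.1 hB
  set c := max a b
  -- Freezing `φ` before `c` makes it monotone and bounded on the whole line.
  have hm : Monotone fun s => φ (max c s) := fun s u hsu =>
    ha ((le_max_left a b).trans (le_max_left c s)) ((le_max_left a b).trans (le_max_left c u))
      (max_le_max_left c hsu)
  have hbd : BddAbove (range fun s => φ (max c s)) :=
    ⟨B, by rintro _ ⟨s, rfl⟩; exact hb _ ((le_max_right a b).trans (le_max_left c s))⟩
  refine ⟨_, (tendsto_atTop_ciSup hm hbd).congr' ?_⟩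
  filter_upwards [eventually_ge_atTop c] with s hs
  rw [max_eq_right hs]

theorem hasDerivAt_const_mul_rpow_neg (B r : ℝ) {s : ℝ} (hs : 0 < s) :
    HasDerivAt (fun s : ℝ => B * s ^ (-r)) (-(B * r * s ^ (-(r + 1)))) s := by
  refine ((Real.hasDerivAt_rpow_const (p := -r) (Or.inl hs.ne')).const_mul B).congr_deriv ?_
  rw [show -r - 1 = -(r + 1) by ring]
  ring

theorem rpow_neg_add_one {s : ℝ} (hs : 0 < s) (r : ℝ) : s ^ (-(r + 1)) = s ^ (-r) / s := by
  rw [show -(r + 1) = -r - 1 by ring, Real.rpow_sub_one hs.ne']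

/-- Subtracting `C/(p-1) s^(-(p-1))`, a primitive of `-C s^(-p)`, makes `w` nondecreasing; `p > 1`
makes this correction vanish at infinity. -/
theorem exists_tendsto_of_neg_rpow_le_deriv {w w' : ℝ → ℝ} {B C p : ℝ} (hp : 1 < p)
    (hd : ∀ᶠ s in atTop, HasDerivAt w (w' s) s)
    (hC : ∀ᶠ s in atTop, -(C * s ^ (-p)) ≤ w' s) (hB : ∀ᶠ s in atTop, w s ≤ B) :
    ∃ l, Tendsto w atTop (𝓝 l) ∧
      ∀ᶠ s in atTop, w s ≤ l + C / (p - 1) * s ^ (-(p - 1)) := by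
  have h0 : Tendsto (fun s : ℝ => C / (p - 1) * s ^ (-(p - 1))) atTop (𝓝 0) := by
    simpa using (tendsto_rpow_neg_atTop (sub_pos.2 hp)).const_mul (C / (p - 1))
  have hd' : ∀ᶠ s in atTop, HasDerivAt (fun s => w s - C / (p - 1) * s ^ (-(p - 1)))
      (w' s + C * s ^ (-p)) s := by
    filter_upwards [hd, eventually_gt_atTop 0] with s hs h0
    refine (hs.sub (hasDerivAt_const_mul_rpow_neg (C / (p - 1)) (p - 1) h0)).congr_deriv ?_
    rw [div_mul_cancel₀ _ (sub_pos.2 hp).ne', sub_add_cancel, sub_neg_eq_add]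
  have hn : ∀ᶠ s in atTop, 0 ≤ w' s + C * s ^ (-p) := by
    filter_upwards [hC] with s hs
    linarith
  obtain ⟨l, hl⟩ := exists_tendsto_of_eventually_deriv_nonneg (B := B + 1) hd' hn (by
    filter_upwards [hB, h0.eventually (Ioi_mem_nhds (show (-1 : ℝ) < 0 by norm_num))] with s h1 h2
    have : -1 < C / (p - 1) * s ^ (-(p - 1)) := h2
    linarith)
  refine ⟨l, by simpa using hl.add h0, ?_⟩
  filter_upwards [eventually_le_of_eventually_deriv_nonneg hd' hn hl] with s hs
  linarith

theorem exists_isBigO_sub_of_abs_deriv_le {w w' : ℝ → ℝ} {B C p : ℝ} (hp : 1 < p)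
    (hd : ∀ᶠ s in atTop, HasDerivAt w (w' s) s)
    (hC : ∀ᶠ s in atTop, |w' s| ≤ C * s ^ (-p)) (hB : ∀ᶠ s in atTop, |w s| ≤ B) :
    ∃ l, (fun s => w s - l) =O[atTop] fun s => s ^ (-(p - 1)) := by
  obtain ⟨l, hl, h1⟩ := exists_tendsto_of_neg_rpow_le_deriv (B := B) (C := C) hp hd
    (hC.mono fun s hs => (abs_le.1 hs).1) (hB.mono fun s hs => (abs_le.1 hs).2)
  obtain ⟨l', hl', h2⟩ := exists_tendsto_of_neg_rpow_le_deriv (B := B) (C := C) hp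
    (hd.mono fun s hs => hs.neg) (hC.mono fun s hs => neg_le_neg (abs_le.1 hs).2)
    (hB.mono fun s hs => neg_le.1 (abs_le.1 hs).1)
  obtain rfl : -l = l' := tendsto_nhds_unique hl.neg hl'
  refine ⟨l, IsBigO.of_bound (C / (p - 1)) ?_⟩
  filter_upwards [h1, h2, eventually_gt_atTop 0] with s h1 h2 hs
  simp only [Pi.neg_apply] at h2
  rw [Real.norm_eq_abs, Real.norm_of_nonneg (Real.rpow_nonneg hs.le _), abs_le]
  constructor <;> linarith

/-- For large `s`, `B s^(-r)` with `B = 2|C|/δ` is a supersolution: half of `δ B` absorbs the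
forcing, the other half the derivative of `s^(-r)`, which is smaller by a factor `1/s`. The
homogeneous part decays exponentially. -/
theorem isBigO_rpow_neg_of_deriv_le {X X' : ℝ → ℝ} {δ C r : ℝ} (hδ : 0 < δ)
    (hd : ∀ᶠ s in atTop, HasDerivAt X (X' s) s) (hX : ∀ᶠ s in atTop, 0 ≤ X s)
    (hC : ∀ᶠ s in atTop, X' s ≤ -(δ * X s) + C * s ^ (-r)) :
    X =O[atTop] fun s => s ^ (-r) := by
  have hC' : ∀ᶠ s in atTop, X' s ≤ -(δ * X s) + |C| * s ^ (-r) := by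
    filter_upwards [hC, eventually_gt_atTop 0] with s hs h0
    have := mul_le_mul_of_nonneg_right (le_abs_self C) (Real.rpow_nonneg h0.le (-r))
    linarith
  set B := 2 * |C| / δ
  have hB : δ * B = 2 * |C| := mul_div_cancel₀ _ hδ.ne'
  have hB0 : 0 ≤ B := by positivity
  have hexp (s : ℝ) : HasDerivAt (fun s => Real.exp (δ * s)) (Real.exp (δ * s) * δ) s := by
    simpa using ((hasDerivAt_id s).const_mul δ).exp
  obtain ⟨a, ha⟩ := exists_monotoneOn_Ici_of_eventually_hasDerivAt
    (φ := fun s => Real.exp (δ * s) * (B * s ^ (-r) - X s))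
    (φ' := fun s => Real.exp (δ * s) * δ * (B * s ^ (-r) - X s) +
      Real.exp (δ * s) * (-(B * r * s ^ (-(r + 1))) - X' s))
    (by
      filter_upwards [hd, eventually_gt_atTop 0] with s hs h0
      exact (hexp s).mul ((hasDerivAt_const_mul_rpow_neg B r h0).sub hs))
    (by
      filter_upwards [hC', eventually_gt_atTop 0, eventually_ge_atTop (2 * r / δ)] with s hs h0 h1
      have hp := Real.rpow_nonneg h0.le (-r)
      have h2 : B * r * s ^ (-(r + 1)) ≤ |C| * s ^ (-r) := by
        have : B * (r / s) ≤ |C| := by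
          have : r / s ≤ δ / 2 := by
            rw [div_le_iff₀ hδ] at h1
            rw [div_le_iff₀ h0]; linarith
          calc B * (r / s) ≤ B * (δ / 2) := mul_le_mul_of_nonneg_left this hB0
            _ = |C| := by linarith
        calc _ = B * (r / s) * s ^ (-r) := by rw [rpow_neg_add_one h0]; ring
          _ ≤ _ := mul_le_mul_of_nonneg_right this hp
      have h3 : δ * (B * s ^ (-r)) = 2 * |C| * s ^ (-r) := by rw [← mul_assoc, hB]
      have : 0 ≤ Real.exp (δ * s) *
          (δ * (B * s ^ (-r)) - δ * X s - B * r * s ^ (-(r + 1)) - X' s) := by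
        refine mul_nonneg (Real.exp_pos _).le ?_
        linarith
      linarith)
  set K := |Real.exp (δ * a) * (B * a ^ (-r) - X a)|
  have h1 : (fun s : ℝ => Real.exp (-δ * s)) =O[atTop] fun s : ℝ => s ^ (-r) :=
    (isLittleO_exp_neg_mul_rpow_atTop hδ (-r)).isBigO
  have h2 : (fun s : ℝ => B * s ^ (-r) + K * Real.exp (-δ * s)) =O[atTop] fun s : ℝ => s ^ (-r) :=
    ((isBigO_refl _ _).const_mul_left B).add (h1.const_mul_left K)
  refine IsBigO.trans (IsBigO.of_bound 1 ?_) h2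
  filter_upwards [hX, eventually_ge_atTop a, eventually_gt_atTop 0] with s hs h3 h0
  have h4 : -K ≤ Real.exp (δ * s) * (B * s ^ (-r) - X s) :=
    (neg_abs_le _).trans (ha (mem_Ici.2 le_rfl) h3 h3)
  have h5 : Real.exp (-δ * s) * Real.exp (δ * s) = 1 := by
    rw [← Real.exp_add]; simp
  have h6 := mul_le_mul_of_nonneg_left h4 (Real.exp_pos (-δ * s)).le
  rw [← mul_assoc, h5] at h6
  rw [Real.norm_of_nonneg hs, one_mul]
  refine le_trans ?_ (le_abs_self _)
  linarith

/-- In the expanding case decay comes from boundedness: `e^{-δs} (X - B s^(-r))` is eventually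
nondecreasing and tends to `0`, so it is nonpositive. -/
theorem isBigO_rpow_neg_of_le_deriv {X X' : ℝ → ℝ} {b δ C r : ℝ} (hδ : 0 < δ) (hr : 0 < r)
    (hd : ∀ᶠ s in atTop, HasDerivAt X (X' s) s) (hX : ∀ᶠ s in atTop, 0 ≤ X s)
    (hb : ∀ᶠ s in atTop, X s ≤ b)
    (hC : ∀ᶠ s in atTop, δ * X s - C * s ^ (-r) ≤ X' s) :
    X =O[atTop] fun s => s ^ (-r) := by
  set B := |C| / δ
  have hB : δ * B = |C| := mul_div_cancel₀ _ hδ.ne'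
  have hB0 : 0 ≤ B := by positivity
  have hexp (s : ℝ) : HasDerivAt (fun s => Real.exp (-δ * s)) (Real.exp (-δ * s) * -δ) s := by
    simpa using ((hasDerivAt_id s).const_mul (-δ)).exp
  have key := eventually_le_of_eventually_deriv_nonneg
    (φ := fun s => Real.exp (-δ * s) * (X s - B * s ^ (-r)))
    (φ' := fun s => Real.exp (-δ * s) * -δ * (X s - B * s ^ (-r)) +
      Real.exp (-δ * s) * (X' s - -(B * r * s ^ (-(r + 1))))) (l := 0)
    (by
      filter_upwards [hd, eventually_gt_atTop 0] with s hs h0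
      exact (hexp s).mul (hs.sub (hasDerivAt_const_mul_rpow_neg B r h0)))
    (by
      filter_upwards [hC, eventually_gt_atTop 0] with s hs h0
      have h1 := mul_le_mul_of_nonneg_right (le_abs_self C) (Real.rpow_nonneg h0.le (-r))
      have h2 : 0 ≤ B * r * s ^ (-(r + 1)) := by positivity
      have h3 : δ * (B * s ^ (-r)) = |C| * s ^ (-r) := by rw [← mul_assoc, hB]
      have : 0 ≤ Real.exp (-δ * s) *
          (X' s - δ * X s + δ * (B * s ^ (-r)) + B * r * s ^ (-(r + 1))) := by
        refine mul_nonneg (Real.exp_pos _).le ?_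
        linarith
      linarith)
    (by
      have he : Tendsto (fun s : ℝ => Real.exp (-δ * s)) atTop (𝓝 0) :=
        Real.tendsto_exp_atBot.comp (tendsto_id.const_mul_atTop_of_neg (neg_neg_of_pos hδ))
      refine (bdd_le_mul_tendsto_zero' (f := fun s => X s - B * s ^ (-r)) (|b| + B)
        ?_ he).congr fun s => mul_comm _ _
      filter_upwards [hX, hb, eventually_ge_atTop 1] with s h1 h2 h3
      have h4 := Real.rpow_le_one_of_one_le_of_nonpos h3 (neg_nonpos.2 hr.le)
      have h5 := mul_le_mul_of_nonneg_left h4 hB0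
      have h6 : 0 ≤ B * s ^ (-r) := by positivity
      have h7 := le_abs_self b
      rw [abs_le]
      constructor <;> linarith [abs_nonneg b])
  refine IsBigO.of_bound B ?_
  filter_upwards [hX, key, eventually_gt_atTop 0] with s hs hk h0
  rw [Real.norm_of_nonneg hs, Real.norm_of_nonneg (Real.rpow_nonneg h0.le _)]
  have := nonpos_of_mul_nonpos_right hk (Real.exp_pos _)
  linarith

theorem isBigO_rpow_neg_rpow_neg {a b : ℝ} (h : b ≤ a) :
    (fun s : ℝ => s ^ (-a)) =O[atTop] fun s : ℝ => s ^ (-b) := by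
  refine IsBigO.of_bound 1 ?_
  filter_upwards [eventually_ge_atTop 1] with s hs
  have h0 : 0 ≤ s := zero_le_one.trans hs
  rw [Real.norm_of_nonneg (Real.rpow_nonneg h0 _), Real.norm_of_nonneg (Real.rpow_nonneg h0 _),
    one_mul]
  exact Real.rpow_le_rpow_of_exponent_le hs (neg_le_neg h)

/-! ### Perturbed gradient flow on the sphere -/

theorem abs_le_one_of_sum_sq_eq_one {ι : Type*} [Fintype ι] {v : ι → ℝ}
    (hv : ∑ i, v i ^ 2 = 1) (i : ι) : |v i| ≤ 1 := by
  rw [← sq_le_one_iff_abs_le_one, ← hv]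
  exact Finset.single_le_sum (f := fun i => v i ^ 2) (fun j _ => sq_nonneg (v j))
    (Finset.mem_univ i)

/-- The sum is the variance of `Λ` under the weights `v i ^ 2`. -/
theorem sum_mul_sub_mul_sq_nonneg {ι : Type*} [Fintype ι] {Λ v : ι → ℝ}
    (hv : ∑ i, v i ^ 2 = 1) : 0 ≤ ∑ i, Λ i * ((Λ i - ∑ j, Λ j * v j ^ 2) * v i ^ 2) := by
  set m := ∑ j, Λ j * v j ^ 2 with hm
  have h0 : ∑ i, (Λ i - m) * v i ^ 2 = 0 := by
    simp only [sub_mul, Finset.sum_sub_distrib, ← Finset.mul_sum, hv]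
    rw [← hm]; ring
  have : ∑ i, Λ i * ((Λ i - m) * v i ^ 2) =
      ∑ i, (Λ i - m) ^ 2 * v i ^ 2 + m * ∑ i, (Λ i - m) * v i ^ 2 := by
    rw [Finset.mul_sum, ← Finset.sum_add_distrib]
    exact Finset.sum_congr rfl fun i _ => by ring
  rw [this, h0, mul_zero, add_zero]
  exact Finset.sum_nonneg fun i _ => by positivity

/-- A bounded solution of `x' = a x + e` with `a` bounded away from zero and of constant sign
decays as fast as `e`. -/
theorem isBigO_rpow_neg_of_hyperbolic {x a e : ℝ → ℝ} {b δ K p : ℝ} (hδ : 0 < δ) (hp : 0 < p)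
    (hd : ∀ᶠ s in atTop, HasDerivAt x (a s * x s + e s) s)
    (hb : ∀ᶠ s in atTop, |x s| ≤ b) (he : ∀ᶠ s in atTop, |e s| ≤ K * s ^ (-p))
    (ha : (∀ᶠ s in atTop, a s ≤ -δ) ∨ ∀ᶠ s in atTop, δ ≤ a s) :
    x =O[atTop] fun s => s ^ (-p) := by
  have hd2 : ∀ᶠ s in atTop, HasDerivAt (fun s => x s ^ 2) (2 * x s * (a s * x s + e s)) s := by
    filter_upwards [hd] with s hs
    exact (hs.pow 2).congr_deriv (by simp)
  have h0 : ∀ᶠ s in atTop, 0 ≤ x s ^ 2 := Eventually.of_forall fun s => sq_nonneg _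
  -- Young's inequality: of the rate `2δ` available for `x²`, one `δ` absorbs the cross term and one
  -- is left.
  have he2 : ∀ᶠ s in atTop, |2 * x s * e s| ≤ δ * x s ^ 2 + K ^ 2 / δ * s ^ (-(2 * p)) := by
    filter_upwards [he, eventually_gt_atTop 0] with s hs hs0
    have h1 : e s ^ 2 ≤ K ^ 2 * s ^ (-(2 * p)) := by
      have : s ^ (-(2 * p)) = (s ^ (-p)) ^ 2 := by
        rw [← Real.rpow_natCast, ← Real.rpow_mul hs0.le]; congr 1; push_cast; ring
      rw [this, ← mul_pow, ← sq_abs]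
      exact pow_le_pow_left₀ (abs_nonneg _) hs 2
    have h2 : |2 * x s * e s| ≤ δ * x s ^ 2 + e s ^ 2 / δ := by
      have h3 : 0 ≤ (δ * |x s| - |e s|) ^ 2 / δ := by positivity
      have h4 : (δ * |x s| - |e s|) ^ 2 / δ = δ * x s ^ 2 + e s ^ 2 / δ - |2 * x s * e s| := by
        rw [abs_mul, abs_mul, abs_two, ← sq_abs (x s), ← sq_abs (e s)]
        field_simp
        ring
      linarith
    calc _ ≤ _ := h2
      _ ≤ δ * x s ^ 2 + K ^ 2 * s ^ (-(2 * p)) / δ := by gcongr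
      _ = _ := by ring
  have hX : (fun s => x s ^ 2) =O[atTop] fun s => s ^ (-(2 * p)) := by
    rcases ha with ha | ha
    · refine isBigO_rpow_neg_of_deriv_le (C := K ^ 2 / δ) hδ hd2 h0 ?_
      filter_upwards [ha, he2] with s h1 h2
      have h3 := mul_le_mul_of_nonneg_right h1 (sq_nonneg (x s))
      have h4 := (abs_le.1 h2).2
      linarith
    · refine isBigO_rpow_neg_of_le_deriv (C := K ^ 2 / δ) (b := b ^ 2) hδ (by linarith) hd2 h0 ?_ ?_
      · filter_upwards [hb] with s hs
        rw [← sq_abs]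
        exact pow_le_pow_left₀ (abs_nonneg _) hs 2
      · filter_upwards [ha, he2] with s h1 h2
        have h3 := mul_le_mul_of_nonneg_right h1 (sq_nonneg (x s))
        have h4 := (abs_le.1 h2).1
        linarith
  refine IsBigO.of_pow two_ne_zero (hX.congr' EventuallyEq.rfl ?_)
  filter_upwards [eventually_gt_atTop 0] with s hs
  rw [Pi.pow_apply, ← Real.rpow_natCast, ← Real.rpow_mul hs.le]
  congr 1; push_cast; ring

theorem hasDerivAt_sum_mul_sq {ι : Type*} [Fintype ι] {v : ℝ → ι → ℝ} {v' : ι → ℝ} {s : ℝ}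
    (Λ : ι → ℝ) (hd : ∀ i, HasDerivAt (fun s => v s i) (v' i) s) :
    HasDerivAt (fun s => ∑ j, Λ j * v s j ^ 2) (∑ j, Λ j * (2 * v s j * v' j)) s :=
  HasDerivAt.fun_sum fun j _ => (by simpa using ((hd j).pow 2).const_mul (Λ j))

/-- Without `e` the derivative of the Rayleigh quotient is `2h` times a variance, hence nonnegative;
`e` costs only an integrable `O(s^(-p))`. -/
theorem exists_tendsto_rayleigh {ι : Type*} [Fintype ι] {Λ : ι → ℝ} {v e : ℝ → ι → ℝ}
    {h : ℝ → ℝ} {K p : ℝ} (hp : 1 < p)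
    (hd : ∀ᶠ s in atTop, ∀ i, HasDerivAt (fun s => v s i)
      (h s * (Λ i - ∑ j, Λ j * v s j ^ 2) * v s i + e s i) s)
    (hv : ∀ᶠ s in atTop, ∑ i, v s i ^ 2 = 1) (hh : ∀ᶠ s in atTop, 0 ≤ h s)
    (he : ∀ᶠ s in atTop, ∀ i, |e s i| ≤ K * s ^ (-p)) :
    ∃ μ, Tendsto (fun s => ∑ j, Λ j * v s j ^ 2) atTop (𝓝 μ) := by
  obtain ⟨μ, hμ, -⟩ := exists_tendsto_of_neg_rpow_le_deriv
    (w := fun s => ∑ j, Λ j * v s j ^ 2) (B := ∑ j, |Λ j|) (C := ∑ j, |Λ j| * 2 * K) hp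
    (hd.mono fun s hs => hasDerivAt_sum_mul_sq Λ hs) (by
      filter_upwards [hv, hh, he] with s hv hh he
      have h1 : ∀ j, -(|Λ j| * 2 * K * s ^ (-p)) ≤ Λ j * (2 * v s j * e s j) := fun j => by
        have : |Λ j * (2 * v s j * e s j)| ≤ |Λ j| * (2 * 1 * (K * s ^ (-p))) := by
          rw [abs_mul, abs_mul, abs_mul, abs_two]
          gcongr
          · exact abs_le_one_of_sum_sq_eq_one hv j
          · exact he j
        have := (abs_le.1 this).1
        linarith
      have h2 := Finset.sum_le_sum fun j (_ : j ∈ Finset.univ) => h1 j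
      have h3 := mul_nonneg hh (sum_mul_sub_mul_sq_nonneg (Λ := Λ) hv)
      have h4 : ∑ j, Λ j * (2 * v s j * (h s * (Λ j - ∑ j, Λ j * v s j ^ 2) * v s j + e s j)) =
          2 * (h s * ∑ i, Λ i * ((Λ i - ∑ j, Λ j * v s j ^ 2) * v s i ^ 2)) +
            ∑ j, Λ j * (2 * v s j * e s j) := by
        rw [Finset.mul_sum, Finset.mul_sum, ← Finset.sum_add_distrib]
        exact Finset.sum_congr rfl fun j _ => by ring
      rw [h4, Finset.sum_mul]
      rw [Finset.sum_neg_distrib] at h2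
      linarith) (by
      filter_upwards [hv] with s hv
      refine Finset.sum_le_sum fun j _ => ?_
      have h1 : v s j ^ 2 ≤ 1 := (sq_le_one_iff_abs_le_one _).2 (abs_le_one_of_sum_sq_eq_one hv j)
      calc Λ j * v s j ^ 2 ≤ |Λ j| * 1 :=
            mul_le_mul (le_abs_self _) h1 (sq_nonneg _) (abs_nonneg _)
        _ = _ := mul_one _)
  exact ⟨μ, hμ⟩

/-- Asymptotics of a perturbed gradient flow of a diagonal quadratic form on the unit sphere. -/
theorem exists_direction_limit {ι : Type*} [Fintype ι] {Λ : ι → ℝ} {v e : ℝ → ι → ℝ}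
    {h : ℝ → ℝ} {c C K p : ℝ} (hp : 1 < p) (hc : 0 < c)
    (hd : ∀ᶠ s in atTop, ∀ i, HasDerivAt (fun s => v s i)
      (h s * (Λ i - ∑ j, Λ j * v s j ^ 2) * v s i + e s i) s)
    (hv : ∀ᶠ s in atTop, ∑ i, v s i ^ 2 = 1) (hh : ∀ᶠ s in atTop, c ≤ h s ∧ h s ≤ C)
    (he : ∀ᶠ s in atTop, ∀ i, |e s i| ≤ K * s ^ (-p)) :
    ∃ (μ : ℝ) (w : ι → ℝ), (∀ i, Λ i * w i = μ * w i) ∧ ∑ i, w i ^ 2 = 1 ∧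
      (∀ i, (fun s => v s i - w i) =O[atTop] fun s => s ^ (-(p - 1))) ∧
      (fun s => ∑ j, Λ j * v s j ^ 2 - μ) =O[atTop] fun s => s ^ (-p) := by
  obtain ⟨μ, hμ⟩ := exists_tendsto_rayleigh hp hd hv (hh.mono fun s hs => hc.le.trans hs.1) he
  have hv1 : ∀ i, ∀ᶠ s in atTop, |v s i| ≤ 1 := fun i =>
    hv.mono fun s hs => abs_le_one_of_sum_sq_eq_one hs i
  -- Eventually the Rayleigh quotient is within `|Λ i - μ| / 2` of `μ`, so the linear coefficient
  -- keeps its sign and stays away from `0`.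
  have hne : ∀ i, Λ i ≠ μ → (fun s => v s i) =O[atTop] fun s => s ^ (-p) := fun i hi => by
    have hdist : 0 < |Λ i - μ| / 2 := by have := abs_pos.2 (sub_ne_zero.2 hi); linarith
    have hnear := (Metric.tendsto_nhds.1 hμ) _ hdist
    refine isBigO_rpow_neg_of_hyperbolic (δ := c * (|Λ i - μ| / 2)) (b := 1)
      (a := fun s => h s * (Λ i - ∑ j, Λ j * v s j ^ 2)) (e := fun s => e s i)
      (mul_pos hc hdist) (by linarith) (hd.mono fun s hs => hs i) (hv1 i)
      (he.mono fun s hs => hs i) ?_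
    rcases lt_or_gt_of_ne hi with hlt | hgt
    · left
      filter_upwards [hnear, hh] with s h1 h2
      rw [Real.dist_eq] at h1
      rw [abs_of_neg (sub_neg.2 hlt)] at h1 ⊢
      have h3 : -(Λ i - μ) / 2 ≤ -(Λ i - ∑ j, Λ j * v s j ^ 2) := by
        have := (abs_lt.1 h1).1
        linarith
      have := mul_le_mul h2.1 h3 (by linarith) (hc.le.trans h2.1)
      linarith
    · right
      filter_upwards [hnear, hh] with s h1 h2
      rw [Real.dist_eq] at h1
      rw [abs_of_pos (sub_pos.2 hgt)] at h1 ⊢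
      have h3 : (Λ i - μ) / 2 ≤ Λ i - ∑ j, Λ j * v s j ^ 2 := by
        have := (abs_lt.1 h1).2
        linarith
      exact mul_le_mul h2.1 h3 (by linarith) (hc.le.trans h2.1)
  -- As `|v| = 1`, the difference is `∑ (Λ j - μ) v_j²`, which involves only the hyperbolic
  -- components.
  have hray : (fun s => ∑ j, Λ j * v s j ^ 2 - μ) =O[atTop] fun s => s ^ (-p) := by
    have h1 : (fun s => ∑ j, (Λ j - μ) * v s j ^ 2) =O[atTop] fun s => s ^ (-p) := by
      refine IsBigO.fun_sum (s := Finset.univ) fun j _ => ?_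
      by_cases hj : Λ j = μ
      · simp only [hj, sub_self, zero_mul]
        exact isBigO_zero _ _
      · refine IsBigO.const_mul_left (IsBigO.trans (IsBigO.of_bound 1 ?_) (hne j hj)) _
        filter_upwards [hv1 j] with s hs
        rw [Real.norm_eq_abs, Real.norm_eq_abs, abs_pow, sq]
        exact mul_le_mul_of_nonneg_right hs (abs_nonneg _)
    refine h1.congr' ?_ EventuallyEq.rfl
    filter_upwards [hv] with s hs
    simp only [sub_mul, Finset.sum_sub_distrib, ← Finset.mul_sum, hs, mul_one]
  have hlim : ∀ i, ∃ w, Λ i * w = μ * w ∧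
      (fun s => v s i - w) =O[atTop] fun s => s ^ (-(p - 1)) := fun i => by
    by_cases hi : Λ i = μ
    -- On the resonant components the coefficient is itself `O(s^(-p))`, so the whole derivative is
    -- integrable; integrating costs one power of `s`.
    · obtain ⟨K', hK'⟩ := hray.bound
      obtain ⟨w, hw⟩ := exists_isBigO_sub_of_abs_deriv_le (w := fun s => v s i) (B := 1)
        (C := C * K' + K) hp (hd.mono fun s hs => hs i) (by
          filter_upwards [hK', he, hh, hv1 i, eventually_gt_atTop 0] with s h1 h2 h3 h4 h5
          rw [Real.norm_eq_abs, Real.norm_of_nonneg (Real.rpow_nonneg h5.le _), abs_sub_comm] at h1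
          have h6 : |h s| ≤ C := by rw [abs_of_nonneg (hc.le.trans h3.1)]; exact h3.2
          calc |h s * (Λ i - ∑ j, Λ j * v s j ^ 2) * v s i + e s i|
              ≤ |h s| * |Λ i - ∑ j, Λ j * v s j ^ 2| * |v s i| + |e s i| := by
                rw [← abs_mul, ← abs_mul]; exact abs_add_le _ _
            _ ≤ C * (K' * s ^ (-p)) * 1 + K * s ^ (-p) := by
                rw [hi]
                have hC : 0 ≤ C := (abs_nonneg _).trans h6
                have hK := (abs_nonneg _).trans h1
                gcongr
                exact h2 i
            _ = _ := by ring) (hv1 i)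
      exact ⟨w, by rw [hi], hw⟩
    · refine ⟨0, by simp, ?_⟩
      simp only [sub_zero]
      exact (hne i hi).trans (isBigO_rpow_neg_rpow_neg (sub_le_self p zero_le_one))
  choose w hw1 hw2 using hlim
  refine ⟨μ, w, hw1, ?_, hw2, hray⟩
  have hvw : ∀ i, Tendsto (fun s => v s i) atTop (𝓝 (w i)) := fun i => by
    simpa using ((hw2 i).trans_tendsto (tendsto_rpow_neg_atTop (sub_pos.2 hp))).add_const (w i)
  exact tendsto_nhds_unique (tendsto_finsetSum _ fun i _ => (hvw i).pow 2)
    (tendsto_const_nhds.congr' (hv.mono fun s hs => hs.symm))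

/-! ### Polar coordinates for a diagonal system -/

theorem hasDerivAt_euclidean_norm {ι : Type*} [Fintype ι] {z : ℝ → EuclideanSpace ℝ ι}
    {z' : ι → ℝ} {s : ℝ} (h0 : z s ≠ 0) (hd : ∀ i, HasDerivAt (fun s => z s i) (z' i) s) :
    HasDerivAt (fun s => ‖z s‖) ((∑ i, z s i * z' i) / ‖z s‖) s := by
  have h1 : HasDerivAt (fun s => ∑ i, z s i ^ 2) (∑ i, 2 * z s i * z' i) s :=
    HasDerivAt.fun_sum fun i _ => ((hd i).pow 2).congr_deriv (by simp)
  have h2 (u : ℝ) : ‖z u‖ = √(∑ i, z u i ^ 2) := by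
    simp [EuclideanSpace.norm_eq]
  have h3 : ∑ i, z s i ^ 2 ≠ 0 := fun h => h0 (norm_eq_zero.1 (by rw [h2, h, Real.sqrt_zero]))
  simp only [h2]
  refine (h1.sqrt h3).congr_deriv ?_
  simp only [mul_assoc]
  rw [← Finset.mul_sum, mul_div_mul_left _ _ two_ne_zero]

theorem sum_sq_div_norm {ι : Type*} [Fintype ι] {z : EuclideanSpace ℝ ι} (h0 : z ≠ 0) :
    ∑ i, (z i / ‖z‖) ^ 2 = 1 := by
  simp only [div_pow]
  rw [← Finset.sum_div, EuclideanSpace.real_norm_sq_eq, div_self]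
  rw [← EuclideanSpace.real_norm_sq_eq]
  exact pow_ne_zero 2 (norm_ne_zero_iff.2 h0)

section Polar

variable {ι : Type*} [Fintype ι] {Λ : ι → ℝ} {z : ℝ → EuclideanSpace ℝ ι} {ε : ι → ℝ} {g s : ℝ}

theorem hasDerivAt_norm_of_diagonal (h0 : z s ≠ 0)
    (hd : ∀ i, HasDerivAt (fun s => z s i) (g * (Λ i * z s i) + ‖z s‖ * ε i) s) :
    HasDerivAt (fun s => ‖z s‖)
      (‖z s‖ * (g * ∑ j, Λ j * (z s j / ‖z s‖) ^ 2 + ∑ j, z s j / ‖z s‖ * ε j)) s := by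
  refine (hasDerivAt_euclidean_norm h0 hd).congr_deriv ?_
  have hN := norm_ne_zero_iff.2 h0
  rw [Finset.mul_sum, ← Finset.sum_add_distrib, Finset.mul_sum, Finset.sum_div]
  refine Finset.sum_congr rfl fun i _ => ?_
  field_simp

theorem hasDerivAt_direction_of_diagonal (h0 : z s ≠ 0)
    (hd : ∀ i, HasDerivAt (fun s => z s i) (g * (Λ i * z s i) + ‖z s‖ * ε i) s) (i : ι) :
    HasDerivAt (fun s => z s i / ‖z s‖)
      (g * (Λ i - ∑ j, Λ j * (z s j / ‖z s‖) ^ 2) * (z s i / ‖z s‖) +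
        (ε i - z s i / ‖z s‖ * ∑ j, z s j / ‖z s‖ * ε j)) s := by
  have hN := norm_ne_zero_iff.2 h0
  refine ((hd i).fun_div (hasDerivAt_norm_of_diagonal h0 hd) hN).congr_deriv ?_
  generalize ∑ j, Λ j * (z s j / ‖z s‖) ^ 2 = m
  generalize ∑ j, z s j / ‖z s‖ * ε j = ψ
  field_simp
  ring

theorem hasDerivAt_norm_rpow_neg_of_diagonal (α : ℝ) (h0 : z s ≠ 0)
    (hd : ∀ i, HasDerivAt (fun s => z s i) (g * (Λ i * z s i) + ‖z s‖ * ε i) s) :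
    HasDerivAt (fun s => ‖z s‖ ^ (-α))
      (-(‖z s‖ ^ (-α) * (α * (g * ∑ j, Λ j * (z s j / ‖z s‖) ^ 2 +
        ∑ j, z s j / ‖z s‖ * ε j)))) s := by
  have hN := norm_ne_zero_iff.2 h0
  refine ((hasDerivAt_norm_of_diagonal h0 hd).rpow_const (p := -α) (Or.inl hN)).congr_deriv ?_
  rw [Real.rpow_sub_one hN]
  field_simp

end Polar

/-! ### Integration from infinity of the equation for `ρ` -/

/-- The barrier `e^{-s} (κ + B s^(-q))` decreases at least as fast as `ρ` can, and both vanish at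
infinity. Hence no constant is lost, and `B = 0` is allowed. -/
theorem eventually_le_exp_neg_mul {ρ k : ℝ → ℝ} {κ B q : ℝ} (hB : 0 ≤ B) (hq : 0 ≤ q)
    (hd : ∀ᶠ s in atTop, HasDerivAt ρ (-(Real.exp (-s) * k s)) s)
    (hρ : Tendsto ρ atTop (𝓝 0)) (hk : ∀ᶠ s in atTop, k s ≤ κ + B * s ^ (-q)) :
    ∀ᶠ s in atTop, ρ s ≤ Real.exp (-s) * (κ + B * s ^ (-q)) := by
  have hexp (s : ℝ) : HasDerivAt (fun s => Real.exp (-s)) (-Real.exp (-s)) s := by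
    simpa using (hasDerivAt_neg s).exp
  have he : Tendsto (fun s : ℝ => Real.exp (-s)) atTop (𝓝 0) := Real.tendsto_exp_neg_atTop_nhds_zero
  have hlim : Tendsto (fun s => Real.exp (-s) * (κ + B * s ^ (-q))) atTop (𝓝 0) := by
    refine (bdd_le_mul_tendsto_zero' (f := fun s : ℝ => κ + B * s ^ (-q)) (|κ| + B)
      ?_ he).congr fun s => mul_comm _ _
    filter_upwards [eventually_ge_atTop 1] with s hs
    have h1 := Real.rpow_le_one_of_one_le_of_nonpos hs (neg_nonpos.2 hq)
    have h2 : 0 ≤ B * s ^ (-q) := mul_nonneg hB (Real.rpow_nonneg (zero_le_one.trans hs) _)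
    calc _ ≤ |κ| + |B * s ^ (-q)| := abs_add_le _ _
      _ ≤ |κ| + B * 1 := by rw [abs_of_nonneg h2]; gcongr
      _ = _ := by rw [mul_one]
  have key := eventually_le_of_eventually_deriv_nonneg (l := 0)
    (φ := fun s => ρ s - Real.exp (-s) * (κ + B * s ^ (-q)))
    (φ' := fun s => -(Real.exp (-s) * k s) - (-Real.exp (-s) * (κ + B * s ^ (-q)) +
      Real.exp (-s) * -(B * q * s ^ (-(q + 1))))) (by
      filter_upwards [hd, eventually_gt_atTop 0] with s h1 h2
      exact h1.sub ((hexp s).mul ((hasDerivAt_const_mul_rpow_neg B q h2).const_add κ))) (by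
      filter_upwards [hk, eventually_gt_atTop 0] with s h1 h2
      have h3 : 0 ≤ B * q * s ^ (-(q + 1)) := by positivity
      have : 0 ≤ Real.exp (-s) * (κ + B * s ^ (-q) - k s + B * q * s ^ (-(q + 1))) :=
        mul_nonneg (Real.exp_pos _).le (by linarith)
      linarith) (by simpa using hρ.sub hlim)
  filter_upwards [key] with s hs
  linarith

theorem eventually_exp_neg_mul_le {ρ k : ℝ → ℝ} {κ B q : ℝ} (hB : 0 ≤ B) (hq : 0 ≤ q)
    (hd : ∀ᶠ s in atTop, HasDerivAt ρ (-(Real.exp (-s) * k s)) s)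
    (hρ : Tendsto ρ atTop (𝓝 0)) (hk : ∀ᶠ s in atTop, κ - B * s ^ (-q) ≤ k s) :
    ∀ᶠ s in atTop, Real.exp (-s) * (κ - B * s ^ (-q)) ≤ ρ s := by
  have := eventually_le_exp_neg_mul (ρ := -ρ) (k := -k) (κ := -κ) hB hq
    (hd.mono fun s hs => hs.neg.congr_deriv (by simp)) (neg_zero (G := ℝ) ▸ hρ.neg) (by
      filter_upwards [hk] with s hs
      simp only [Pi.neg_apply]
      linarith)
  filter_upwards [this] with s hs
  simp only [Pi.neg_apply] at hs
  linarith

theorem exp_mul_sub_isBigO {ρ k : ℝ → ℝ} {κ q : ℝ} (hq : 0 ≤ q)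
    (hd : ∀ᶠ s in atTop, HasDerivAt ρ (-(Real.exp (-s) * k s)) s)
    (hρ : Tendsto ρ atTop (𝓝 0)) (hk : (fun s => k s - κ) =O[atTop] fun s => s ^ (-q)) :
    (fun s => Real.exp s * ρ s - κ) =O[atTop] fun s => s ^ (-q) := by
  obtain ⟨B, hB, hkB⟩ := hk.exists_pos
  have hkB : ∀ᶠ s in atTop, |k s - κ| ≤ B * s ^ (-q) := by
    filter_upwards [hkB.bound, eventually_gt_atTop 0] with s h1 h2
    rwa [Real.norm_eq_abs, Real.norm_of_nonneg (Real.rpow_nonneg h2.le _)] at h1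
  have h1 := eventually_le_exp_neg_mul (κ := κ) hB.le hq hd hρ
    (hkB.mono fun s hs => by linarith [(abs_le.1 hs).2])
  have h2 := eventually_exp_neg_mul_le (κ := κ) hB.le hq hd hρ
    (hkB.mono fun s hs => by linarith [(abs_le.1 hs).1])
  refine IsBigO.of_bound B ?_
  filter_upwards [h1, h2, eventually_gt_atTop 0] with s h1 h2 hs
  rw [Real.norm_eq_abs, Real.norm_of_nonneg (Real.rpow_nonneg hs.le _)]
  have he : Real.exp s * Real.exp (-s) = 1 := by rw [← Real.exp_add]; simp
  have h1 := mul_le_mul_of_nonneg_left h1 (Real.exp_pos s).le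
  have h2 := mul_le_mul_of_nonneg_left h2 (Real.exp_pos s).le
  rw [← mul_assoc, he, one_mul] at h1 h2
  rw [abs_le]
  constructor <;> linarith

/-! ### Hölder homogeneous functions and auxiliary estimates -/

theorem exists_pos_forall_le {ι : Type*} [Finite ι] {Λ : ι → ℝ} (h : ∀ i, 0 < Λ i) :
    ∃ m, 0 < m ∧ ∀ i, m ≤ Λ i := by
  cases isEmpty_or_nonempty ι
  · exact ⟨1, one_pos, isEmptyElim⟩
  · obtain ⟨i, hi⟩ := Finite.exists_min Λ
    exact ⟨Λ i, h i, hi⟩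

theorem norm_sub_rpow_tendsto_zero {X : Type*} [NormedAddCommGroup X] {γ : ℝ} (hγ : 0 < γ)
    (x : X) : Tendsto (fun u => ‖u - x‖ ^ γ) (𝓝 x) (𝓝 0) := by
  have : Continuous fun u => ‖u - x‖ ^ γ :=
    (continuous_id.sub continuous_const).norm.rpow_const fun _ => Or.inr hγ.le
  simpa [hγ.ne'] using this.tendsto x

/-- A positive function on `X ∖ {0}`, homogeneous of degree `α`, with a local Hölder estimate of
exponent `γ` at every nonzero point. -/
structure IsHolderHomogeneous {X : Type*} [NormedAddCommGroup X] [NormedSpace ℝ X] (α γ : ℝ)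
    (H : X → ℝ) : Prop where
  hom : PosHomogeneous α H
  pos : ∀ x, x ≠ 0 → 0 < H x
  holder : ∀ x, x ≠ 0 → (fun u => H u - H x) =O[𝓝 x] fun u => ‖u - x‖ ^ γ

namespace IsHolderHomogeneous

variable {X : Type*} [NormedAddCommGroup X] [NormedSpace ℝ X] {α γ : ℝ} {H : X → ℝ}

theorem continuousAt (hH : IsHolderHomogeneous α γ H) (hγ : 0 < γ) {x : X} (hx : x ≠ 0) :
    ContinuousAt H x := by
  have h2 := ((hH.holder x hx).trans_tendsto (norm_sub_rpow_tendsto_zero hγ x)).add_const (H x)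
  simpa [ContinuousAt] using h2

theorem exists_bounds [ProperSpace X] (hH : IsHolderHomogeneous α γ H) (hγ : 0 < γ) :
    ∃ a b, 0 < a ∧ 0 < b ∧ ∀ x, ‖x‖ = 1 → a ≤ H x ∧ H x ≤ b := by
  have hS : IsCompact (Metric.sphere (0 : X) 1) := isCompact_sphere 0 1
  have h0 : ∀ x ∈ Metric.sphere (0 : X) 1, x ≠ 0 := fun x hx =>
    ne_zero_of_mem_unit_sphere ⟨x, hx⟩
  have hcont : ContinuousOn H (Metric.sphere (0 : X) 1) := fun x hx =>
    (hH.continuousAt hγ (h0 x hx)).continuousWithinAt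
  rcases (Metric.sphere (0 : X) 1).eq_empty_or_nonempty with he | hne
  · refine ⟨1, 1, one_pos, one_pos, fun x hx => ?_⟩
    have : x ∈ Metric.sphere (0 : X) 1 := by simpa using hx
    simp [he] at this
  · obtain ⟨u, hu, hu'⟩ := hS.exists_isMinOn hne hcont
    obtain ⟨w, hw, hw'⟩ := hS.exists_isMaxOn hne hcont
    refine ⟨H u, H w, hH.pos u (h0 u hu), hH.pos w (h0 w hw), fun x hx => ?_⟩
    have : x ∈ Metric.sphere (0 : X) 1 := by simpa using hx
    exact ⟨hu' this, hw' this⟩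

theorem apply_normalize (hH : IsHolderHomogeneous α γ H) {x : X} (hx : x ≠ 0) :
    H (‖x‖⁻¹ • x) = ‖x‖ ^ (-α) * H x := by
  rw [hH.hom x hx _ (inv_pos.2 (norm_pos_iff.2 hx)), smul_eq_mul, Real.rpow_neg (norm_nonneg _),
    Real.inv_rpow (norm_nonneg _)]

end IsHolderHomogeneous

theorem isBigO_euclidean_of_coord {ι β : Type*} [Fintype ι] {u : β → EuclideanSpace ℝ ι}
    {x : EuclideanSpace ℝ ι} {r : β → ℝ} {l : Filter β}
    (h : ∀ i, (fun s => u s i - x i) =O[l] r) : (fun s => u s - x) =O[l] r := by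
  have h1 : (fun s => (WithLp.linearEquiv 2 ℝ (ι → ℝ)) (u s - x)) =O[l] r :=
    isBigO_pi.2 fun i => h i
  have h2 := (PiLp.continuousLinearEquiv 2 ℝ fun _ : ι => ℝ).symm.isBigO_comp
    (fun s => WithLp.ofLp (u s - x)) l
  exact h2.trans h1

theorem abs_sum_mul_le {ι : Type*} [Fintype ι] {v e : ι → ℝ} {b : ℝ}
    (hv : ∑ i, v i ^ 2 = 1) (he : ∀ i, |e i| ≤ b) :
    |∑ i, v i * e i| ≤ Fintype.card ι * b := by
  refine (Finset.abs_sum_le_sum_abs _ _).trans ?_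
  have : ∀ i ∈ Finset.univ, |v i * e i| ≤ b := fun i _ => by
    rw [abs_mul, ← one_mul b]
    exact mul_le_mul (abs_le_one_of_sum_sq_eq_one hv i) (he i) (abs_nonneg _) zero_le_one
  simpa [nsmul_eq_mul] using Finset.sum_le_card_nsmul _ _ _ this

theorem rayleigh_bounds {ι : Type*} [Fintype ι] {Λ v : ι → ℝ} {m : ℝ} (hm0 : 0 ≤ m)
    (hm : ∀ i, m ≤ Λ i) (hv : ∑ i, v i ^ 2 = 1) :
    m ≤ ∑ j, Λ j * v j ^ 2 ∧ ∑ j, Λ j * v j ^ 2 ≤ ∑ j, Λ j := by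
  constructor
  · calc m = ∑ j, m * v j ^ 2 := by rw [← Finset.mul_sum, hv, mul_one]
      _ ≤ _ := Finset.sum_le_sum fun j _ => mul_le_mul_of_nonneg_right (hm j) (sq_nonneg _)
  · refine Finset.sum_le_sum fun j _ => mul_le_of_le_one_right (hm0.trans (hm j)) ?_
    exact (sq_le_one_iff_abs_le_one _).2 (abs_le_one_of_sum_sq_eq_one hv j)

/-- Asymptotics of `ρ = |z|^(-α)` and of the direction `z / |z|` give those of `z`. -/
theorem isBigO_exp_smul_sub {X : Type*} [NormedAddCommGroup X] [NormedSpace ℝ X] {z : ℝ → X}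
    {x : X} {α κ : ℝ} {r : ℝ → ℝ} (hα : 0 < α) (hκ : 0 < κ) (hz : ∀ᶠ s in atTop, z s ≠ 0)
    (hr : Tendsto r atTop (𝓝 0))
    (hdir : (fun s => ‖z s‖⁻¹ • z s - x) =O[atTop] r)
    (hρ : (fun s => Real.exp s * ‖z s‖ ^ (-α) - κ) =O[atTop] r) :
    (fun s => Real.exp (-s / α) • z s - κ ^ (-1 / α) • x) =O[atTop] r := by
  have hlim : Tendsto (fun s => Real.exp s * ‖z s‖ ^ (-α)) atTop (𝓝 κ) := by
    simpa using (hρ.trans_tendsto hr).add_const κ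
  -- The map `u ↦ u^(-1/α)` is differentiable at `κ > 0`, so it preserves rates; it sends `e^s ρ` to
  -- `e^{-s/α} ‖z‖`.
  have h1 : (fun s => (Real.exp s * ‖z s‖ ^ (-α)) ^ (-1 / α) - κ ^ (-1 / α)) =O[atTop] r :=
    ((Real.hasDerivAt_rpow_const (p := -1 / α)
      (Or.inl hκ.ne')).differentiableAt.isBigO_sub.comp_tendsto hlim).trans hρ
  have hV : (fun s => ‖z s‖⁻¹ • z s) =O[atTop] fun _ => (1 : ℝ) := by
    refine IsBigO.of_bound 1 ?_
    filter_upwards [hz] with s hs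
    rw [norm_smul, norm_inv, norm_norm, inv_mul_cancel₀ (norm_ne_zero_iff.2 hs)]
    simp
  have h2 := h1.smul hV
  simp only [smul_eq_mul, mul_one] at h2
  refine (h2.add (hdir.const_smul_left (κ ^ (-1 / α)))).congr' ?_ EventuallyEq.rfl
  filter_upwards [hz] with s hs
  have hN := norm_pos_iff.2 hs
  have h3 : (Real.exp s * ‖z s‖ ^ (-α)) ^ (-1 / α) = Real.exp (-s / α) * ‖z s‖ := by
    rw [Real.mul_rpow (Real.exp_pos s).le (Real.rpow_nonneg hN.le _), ← Real.rpow_mul hN.le,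
      ← Real.exp_mul]
    congr 1
    · congr 1; ring
    · rw [show -α * (-1 / α) = 1 by field_simp, Real.rpow_one]
  rw [h3, sub_smul, mul_smul, smul_inv_smul₀ hN.ne', Pi.smul_apply, smul_sub]
  abel

/-! ### Asymptotic profile in diagonal coordinates -/

namespace IsHolderHomogeneous

theorem exists_profile_of_diagonal {ι : Type*} [Fintype ι] {Λ : ι → ℝ}
    {H : EuclideanSpace ℝ ι → ℝ} {α γ K p : ℝ} (hH : IsHolderHomogeneous α γ H) (hα : 0 < α)
    (hγ : 0 < γ) (hγ1 : γ ≤ 1) (hp : 1 < p) (hΛ : ∀ i, 0 < Λ i) {z : ℝ → EuclideanSpace ℝ ι}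
    {F : ℝ → ι → ℝ} (hz : ∀ᶠ s in atTop, z s ≠ 0)
    (hinf : Tendsto (fun s => ‖z s‖) atTop atTop)
    (hd : ∀ᶠ s in atTop, ∀ i, HasDerivAt (fun s => z s i)
      (Real.exp (-s) * (H (z s) * (Λ i * z s i) + F s i)) s)
    (hF : ∀ᶠ s in atTop, ∀ i, |F s i| ≤ ‖z s‖ ^ (1 + α) * (K * s ^ (-p))) :
    ∃ (μ : ℝ) (ξ : EuclideanSpace ℝ ι), ξ ≠ 0 ∧ (∀ i, Λ i * ξ i = μ * ξ i) ∧ α * μ * H ξ = 1 ∧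
      (fun s => Real.exp (-s / α) • z s - ξ) =O[atTop] fun s => s ^ (-(γ * (p - 1))) := by
  have hq : 0 < γ * (p - 1) := mul_pos hγ (sub_pos.2 hp)
  obtain ⟨m, hm0, hm⟩ := exists_pos_forall_le hΛ
  obtain ⟨a, b, ha, hb, hab⟩ := hH.exists_bounds hγ
  set v : ℝ → ι → ℝ := fun s i => z s i / ‖z s‖ with hv_def
  set V : ℝ → EuclideanSpace ℝ ι := fun s => ‖z s‖⁻¹ • z s with hV_def
  set g : ℝ → ℝ := fun s => Real.exp (-s) * H (z s) with hg_def
  set ε : ℝ → ι → ℝ := fun s i => Real.exp (-s) * F s i / ‖z s‖ with hε_def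
  set ρ : ℝ → ℝ := fun s => ‖z s‖ ^ (-α) with hρ_def
  set lam : ℝ → ℝ := fun s => ∑ j, Λ j * v s j ^ 2 with hlam_def
  set ψ : ℝ → ℝ := fun s => ∑ j, v s j * ε s j with hψ_def
  set k : ℝ → ℝ := fun s => α * (H (V s) * lam s + Real.exp s * (ρ s * ψ s)) with hk_def
  have hexp (s : ℝ) : Real.exp (-s) * Real.exp s = 1 := by rw [← Real.exp_add]; simp
  have hv : ∀ᶠ s in atTop, ∑ i, v s i ^ 2 = 1 := hz.mono fun s hs => sum_sq_div_norm hs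
  have hVnorm : ∀ᶠ s in atTop, ‖V s‖ = 1 := by
    filter_upwards [hz] with s hs
    rw [hV_def, norm_smul, norm_inv, norm_norm, inv_mul_cancel₀ (norm_ne_zero_iff.2 hs)]
  have hGρ : ∀ᶠ s in atTop, H (V s) = ρ s * H (z s) := hz.mono fun s hs => hH.apply_normalize hs
  have hρpos : ∀ᶠ s in atTop, 0 < ρ s := hz.mono fun s hs =>
    Real.rpow_pos_of_pos (norm_pos_iff.2 hs) _
  have hρ0 : Tendsto ρ atTop (𝓝 0) := (tendsto_rpow_neg_atTop hα).comp hinf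
  have hd' : ∀ᶠ s in atTop, ∀ i, HasDerivAt (fun s => z s i)
      (g s * (Λ i * z s i) + ‖z s‖ * ε s i) s := by
    filter_upwards [hd, hz] with s hs h0 i
    refine (hs i).congr_deriv ?_
    simp only [hg_def, hε_def]
    rw [mul_div_cancel₀ _ (norm_ne_zero_iff.2 h0)]
    ring
  -- Only the product `ρ ε` can be bounded now; the bound on `ε` itself needs `ρ ≥ c₁ e^{-s}`, which
  -- comes later.
  have hερ : ∀ᶠ s in atTop, ∀ i, ρ s * |ε s i| ≤ Real.exp (-s) * (K * s ^ (-p)) := by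
    filter_upwards [hF, hz] with s hs h0 i
    have hN := norm_pos_iff.2 h0
    have h1 : ρ s * |ε s i| = Real.exp (-s) * (‖z s‖ ^ (-(1 + α)) * |F s i|) := by
      simp only [hρ_def, hε_def]
      rw [abs_div, abs_mul, abs_of_pos (Real.exp_pos _), abs_of_pos hN,
        show -(1 + α) = -α - 1 by ring, Real.rpow_sub_one hN.ne']
      ring
    rw [h1]
    refine mul_le_mul_of_nonneg_left ?_ (Real.exp_pos _).le
    refine (mul_le_mul_of_nonneg_left (hs i) (Real.rpow_nonneg hN.le _)).trans_eq ?_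
    rw [← mul_assoc, ← Real.rpow_add hN]
    simp
  have hη : ∀ᶠ s in atTop, |Real.exp s * (ρ s * ψ s)| ≤ Fintype.card ι * (K * s ^ (-p)) := by
    filter_upwards [hv, hερ, hρpos] with s h1 h2 h3
    have h4 : Real.exp s * (ρ s * ψ s) = ∑ j, v s j * (Real.exp s * (ρ s * ε s j)) := by
      rw [hψ_def, Finset.mul_sum, Finset.mul_sum]
      exact Finset.sum_congr rfl fun j _ => by ring
    rw [h4]
    refine abs_sum_mul_le h1 fun i => ?_
    rw [abs_mul, abs_mul, abs_of_pos (Real.exp_pos _), abs_of_pos h3]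
    refine (mul_le_mul_of_nonneg_left (h2 i) (Real.exp_pos s).le).trans_eq ?_
    rw [← mul_assoc, mul_comm (Real.exp s), hexp, one_mul]
  have hηO : (fun s => Real.exp s * (ρ s * ψ s)) =O[atTop] fun s => s ^ (-p) := by
    refine IsBigO.of_bound (Fintype.card ι * K) ?_
    filter_upwards [hη, eventually_gt_atTop 0] with s h1 h2
    rw [Real.norm_eq_abs, Real.norm_of_nonneg (Real.rpow_nonneg h2.le _), mul_assoc]
    exact h1
  have hdρ : ∀ᶠ s in atTop, HasDerivAt ρ (-(Real.exp (-s) * k s)) s := by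
    filter_upwards [hd', hz, hGρ] with s h1 h2 h3
    refine (hasDerivAt_norm_rpow_neg_of_diagonal α h2 h1).congr_deriv ?_
    change -(ρ s * (α * (g s * lam s + ψ s))) = _
    simp only [hk_def, hg_def, h3]
    linear_combination α * ρ s * ψ s * hexp s
  -- The product `a * m` bounds the main term of `k / α` from below; the error may take half of it.
  have hηsmall : ∀ᶠ s in atTop, |Real.exp s * (ρ s * ψ s)| ≤ a * m / 2 := by
    have := (hηO.trans_tendsto (tendsto_rpow_neg_atTop (zero_lt_one.trans hp))).abs
    rw [abs_zero] at this
    exact this.eventually (Iic_mem_nhds (by positivity))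
  have hkb : ∀ᶠ s in atTop, α * (a * m / 2) ≤ k s ∧
      k s ≤ α * (b * ∑ j, Λ j + a * m / 2) := by
    filter_upwards [hηsmall, hVnorm, hv] with s h1 h2 h3
    obtain ⟨h4, h5⟩ := hab _ h2
    obtain ⟨h6, h7⟩ := rayleigh_bounds hm0.le hm h3
    have h8 : a * m ≤ H (V s) * lam s := mul_le_mul h4 h6 hm0.le (ha.le.trans h4)
    have h9 : H (V s) * lam s ≤ b * ∑ j, Λ j := mul_le_mul h5 h7 (hm0.le.trans h6) hb.le
    have h10 := abs_le.1 h1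
    constructor <;> refine mul_le_mul_of_nonneg_left ?_ hα.le <;> linarith
  set c₁ := α * (a * m / 2) with hc₁
  set c₂ := α * (b * ∑ j, Λ j + a * m / 2) with hc₂
  have hc₁pos : 0 < c₁ := by positivity
  have hc₂pos : 0 < c₂ := by
    obtain ⟨s, hs⟩ := hkb.exists
    linarith
  have hρup : ∀ᶠ s in atTop, ρ s ≤ Real.exp (-s) * c₂ := by
    simpa using eventually_le_exp_neg_mul (κ := c₂) (B := 0) le_rfl le_rfl hdρ hρ0
      (by simpa using hkb.mono fun s hs => hs.2)
  have hρlow : ∀ᶠ s in atTop, Real.exp (-s) * c₁ ≤ ρ s := by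
    simpa using eventually_exp_neg_mul_le (κ := c₁) (B := 0) le_rfl le_rfl hdρ hρ0
      (by simpa using hkb.mono fun s hs => hs.1)
  -- Here `g = e^{-s} H(V) / ρ`, and `ρ` is comparable to `e^{-s}`.
  have hgb : ∀ᶠ s in atTop, a / c₂ ≤ g s ∧ g s ≤ b / c₁ := by
    filter_upwards [hρup, hρlow, hVnorm, hGρ, hz] with s h1 h2 h3 h4 h5
    obtain ⟨h6, h7⟩ := hab _ h3
    have hHz := hH.pos _ h5
    rw [div_le_iff₀ hc₂pos, le_div_iff₀ hc₁pos]
    rw [h4] at h6 h7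
    have h8 := mul_le_mul_of_nonneg_right h1 hHz.le
    have h9 := mul_le_mul_of_nonneg_right h2 hHz.le
    constructor <;> simp only [hg_def] <;> linarith
  have hε : ∀ᶠ s in atTop, ∀ i, |ε s i| ≤ K / c₁ * s ^ (-p) := by
    filter_upwards [hρlow, hερ] with s h1 h2 i
    have h3 := (mul_le_mul_of_nonneg_right h1 (abs_nonneg (ε s i))).trans (h2 i)
    rw [mul_assoc] at h3
    have h4 := le_of_mul_le_mul_left h3 (Real.exp_pos _)
    rw [div_mul_eq_mul_div, le_div_iff₀ hc₁pos]
    linarith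
  obtain ⟨μ, w, hw, hw1, hvw, hlam⟩ := exists_direction_limit (Λ := Λ) (v := v)
    (e := fun s i => ε s i - v s i * ψ s) (h := g) (c := a / c₂) (C := b / c₁)
    (K := (1 + Fintype.card ι) * (K / c₁)) hp (div_pos ha hc₂pos) (by
      filter_upwards [hd', hz] with s h1 h2 i
      exact hasDerivAt_direction_of_diagonal h2 h1 i) hv hgb (by
      filter_upwards [hε, hv] with s h1 h2 i
      have h3 : |v s i * ψ s| ≤ 1 * (Fintype.card ι * (K / c₁ * s ^ (-p))) := by
        rw [abs_mul]
        exact mul_le_mul (abs_le_one_of_sum_sq_eq_one h2 i) (abs_sum_mul_le h2 h1)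
          (abs_nonneg _) zero_le_one
      refine (abs_sub _ _).trans ?_
      linarith [h1 i])
  obtain ⟨i₀, hi₀⟩ : ∃ i, w i ≠ 0 := by
    by_contra! h
    simp [h] at hw1
  have hμ : 0 < μ := by rw [← mul_right_cancel₀ hi₀ (hw i₀)]; exact hΛ i₀
  set x : EuclideanSpace ℝ ι := WithLp.toLp 2 w with hx_def
  have hx0 : x ≠ 0 := fun h => hi₀ (by simpa [hx_def] using congrArg (fun u => u i₀) h)
  have hVx : (fun s => V s - x) =O[atTop] fun s => s ^ (-(p - 1)) := by
    refine isBigO_euclidean_of_coord fun i => (hvw i).congr_left fun s => ?_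
    simp [hv_def, hV_def, hx_def, div_eq_inv_mul]
  have hVlim : Tendsto V atTop (𝓝 x) := by
    simpa using (hVx.trans_tendsto (tendsto_rpow_neg_atTop (sub_pos.2 hp))).add_const x
  have hG : (fun s => H (V s) - H x) =O[atTop] fun s => s ^ (-(γ * (p - 1))) := by
    refine ((hH.holder x hx0).comp_tendsto hVlim).trans ?_
    have h1 : (fun s => ‖V s - x‖ ^ γ) =O[atTop] fun s : ℝ => (s ^ (-(p - 1))) ^ γ :=
      IsBigO.rpow hγ.le (by
        filter_upwards [eventually_gt_atTop 0] with s hs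
        exact Real.rpow_nonneg hs.le _) hVx.norm_left
    refine h1.congr' EventuallyEq.rfl ?_
    filter_upwards [eventually_gt_atTop 0] with s hs
    rw [← Real.rpow_mul hs.le]
    congr 1; ring
  -- The slowest rate is that of `H (V s)`; `γ ≤ 1` lets it dominate the direction and the error
  -- terms.
  have hqp : γ * (p - 1) ≤ p - 1 := mul_le_of_le_one_left (sub_pos.2 hp).le hγ1
  have hpO := isBigO_rpow_neg_rpow_neg (a := p) (b := γ * (p - 1)) (by linarith)
  have hlamB : lam =O[atTop] fun _ => (1 : ℝ) := by
    have := (hlam.trans_tendsto (tendsto_rpow_neg_atTop (zero_lt_one.trans hp))).add_const μ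
    simp only [sub_add_cancel] at this
    exact this.isBigO_one ℝ
  have hk : (fun s => k s - α * (H x * μ)) =O[atTop] fun s => s ^ (-(γ * (p - 1))) := by
    have h1 := hG.mul hlamB
    simp only [mul_one] at h1
    have h2 := (h1.add ((hlam.trans hpO).const_mul_left (H x))).add (hηO.trans hpO)
    refine (h2.const_mul_left α).congr_left fun s => ?_
    simp only [hk_def, hlam_def]
    ring
  have hHx := hH.pos x hx0
  have hκ : 0 < α * (H x * μ) := by positivity
  have hρκ := exp_mul_sub_isBigO hq.le hdρ hρ0 hk
  have hc : 0 < (α * (H x * μ)) ^ (-1 / α) := Real.rpow_pos_of_pos hκ _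
  -- By homogeneity the factor `κ^(-1/α)`, with `κ = α μ H x`, divides `H x` by `κ`, which yields
  -- the normalization.
  refine ⟨μ, (α * (H x * μ)) ^ (-1 / α) • x, smul_ne_zero hc.ne' hx0, fun i => ?_, ?_, ?_⟩
  · simp only [hx_def, PiLp.smul_apply, smul_eq_mul]
    linear_combination (α * (H x * μ)) ^ (-1 / α) * hw i
  · rw [hH.hom x hx0 _ hc, ← Real.rpow_mul hκ.le, div_mul_cancel₀ _ hα.ne', Real.rpow_neg_one,
      smul_eq_mul]
    field_simp
  · exact isBigO_exp_smul_sub hα hκ hz (tendsto_rpow_neg_atTop hq)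
      (hVx.trans (isBigO_rpow_neg_rpow_neg hqp)) hρκ

end IsHolderHomogeneous

/-! ### From the sphere to all nonzero points, and linear changes of variable -/

theorem isBigO_sub_norm_sub_rpow {X Y : Type*} [NormedAddCommGroup X] [NormedAddCommGroup Y]
    {γ : ℝ} (hγ1 : γ ≤ 1) {G : X → Y} {x : X}
    (hG : (fun u => G u - G x) =O[𝓝 x] fun u => u - x) (hγ : 0 < γ) :
    (fun u => G u - G x) =O[𝓝 x] fun u => ‖u - x‖ ^ γ := by
  refine hG.trans (IsBigO.of_bound 1 ?_)
  filter_upwards [Metric.ball_mem_nhds x one_pos] with u hu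
  rw [mem_ball_iff_norm] at hu
  rw [Real.norm_of_nonneg (Real.rpow_nonneg (norm_nonneg _) _), one_mul]
  rcases (norm_nonneg (u - x)).eq_or_lt with h0 | h0
  · rw [← h0, Real.zero_rpow hγ.ne']
  · simpa using Real.rpow_le_rpow_of_exponent_ge h0 hu.le hγ1

theorem PosHomogeneous.eq_norm_rpow_mul {X : Type*} [NormedAddCommGroup X] [NormedSpace ℝ X]
    {α : ℝ} {H : X → ℝ} (hH : PosHomogeneous α H) {x : X} (hx : x ≠ 0) :
    H x = ‖x‖ ^ α * H (‖x‖⁻¹ • x) := by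
  have hN := norm_pos_iff.2 hx
  have h := hH _ (smul_ne_zero (inv_ne_zero hN.ne') hx) ‖x‖ hN
  rwa [smul_inv_smul₀ hN.ne', smul_eq_mul] at h

namespace IsHolderHomogeneous

/-- Off the origin `H u = ‖u‖^α H(u/‖u‖)`, with norm power and normalization differentiable; `γ ≤ 1`
absorbs their Lipschitz errors into Hölder ones. -/
theorem of_sphere {n : ℕ} {α γ : ℝ} {H : EuclideanSpace ℝ (Fin n) → ℝ}
    (hγ : 0 < γ) (hγ1 : γ ≤ 1) (hhom : PosHomogeneous α H)
    (hpos : ∀ x ∈ Metric.sphere (0 : EuclideanSpace ℝ (Fin n)) 1, 0 < H x)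
    (hHC : HasPropertyHCWith γ H (Metric.sphere (0 : EuclideanSpace ℝ (Fin n)) 1)) :
    IsHolderHomogeneous α γ H where
  hom := hhom
  pos x hx := by
    rw [hhom.eq_norm_rpow_mul hx]
    refine mul_pos (Real.rpow_pos_of_pos (norm_pos_iff.2 hx) _) (hpos _ ?_)
    simp [norm_smul, hx]
  holder x hx := by
    have hmem {u : EuclideanSpace ℝ (Fin n)} (hu : u ≠ 0) :
        ‖u‖⁻¹ • u ∈ Metric.sphere (0 : EuclideanSpace ℝ (Fin n)) 1 := by
      simp [norm_smul, hu]
    have hN := norm_ne_zero_iff.2 hx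
    have hdn : DifferentiableAt ℝ (fun u : EuclideanSpace ℝ (Fin n) => ‖u‖) x :=
      differentiableAt_id.norm ℝ hx
    have hπ : (fun u : EuclideanSpace ℝ (Fin n) => ‖u‖⁻¹ • u - ‖x‖⁻¹ • x) =O[𝓝 x]
        fun u => u - x := ((hdn.inv hN).smul differentiableAt_id).isBigO_sub
    have hπlim : Tendsto (fun u : EuclideanSpace ℝ (Fin n) => ‖u‖⁻¹ • u) (𝓝 x)
        (𝓝 (‖x‖⁻¹ • x)) := ((hdn.inv hN).smul differentiableAt_id).continuousAt
    have hnorm : (fun u : EuclideanSpace ℝ (Fin n) => ‖u‖ ^ α - ‖x‖ ^ α) =O[𝓝 x]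
        fun u => ‖u - x‖ ^ γ :=
      isBigO_sub_norm_sub_rpow hγ1 (hdn.rpow_const (Or.inl hN)).isBigO_sub hγ
    have hdir : (fun u : EuclideanSpace ℝ (Fin n) => H (‖u‖⁻¹ • u) - H (‖x‖⁻¹ • x)) =O[𝓝 x]
        fun u => ‖u - x‖ ^ γ := by
      obtain ⟨r, C, hr, -, hC⟩ := hHC _ (hmem hx)
      have h1 : (fun u : EuclideanSpace ℝ (Fin n) => ‖‖u‖⁻¹ • u - ‖x‖⁻¹ • x‖ ^ γ) =O[𝓝 x]
          fun u => ‖u - x‖ ^ γ :=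
        IsBigO.rpow hγ.le (Eventually.of_forall fun u => norm_nonneg _) hπ.norm_norm
      refine IsBigO.trans (IsBigO.of_bound C ?_) h1
      filter_upwards [hπlim.eventually (Metric.ball_mem_nhds _ hr), isOpen_ne.mem_nhds hx]
        with u hu hu0
      rw [Real.norm_eq_abs, Real.norm_of_nonneg (Real.rpow_nonneg (norm_nonneg _) _)]
      exact hC _ (hmem hu0) (mem_ball_iff_norm.1 hu)
    have hbdd : (fun u : EuclideanSpace ℝ (Fin n) => H (‖u‖⁻¹ • u)) =O[𝓝 x]
        fun _ => (1 : ℝ) := by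
      have := (hdir.trans_tendsto (norm_sub_rpow_tendsto_zero hγ x)).add_const (H (‖x‖⁻¹ • x))
      simp only [sub_add_cancel] at this
      exact this.isBigO_one ℝ
    have h1 := hnorm.mul hbdd
    simp only [mul_one] at h1
    refine (h1.add (hdir.const_mul_left (‖x‖ ^ α))).congr' ?_ EventuallyEq.rfl
    filter_upwards [isOpen_ne.mem_nhds hx] with u hu
    rw [hhom.eq_norm_rpow_mul hu, hhom.eq_norm_rpow_mul hx]
    ring

/-- A linear change of coordinates need not preserve the sphere, hence a Hölder condition at all
nonzero points. -/
theorem comp {X Y : Type*} [NormedAddCommGroup X] [NormedSpace ℝ X] [NormedAddCommGroup Y]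
    [NormedSpace ℝ Y] {α γ : ℝ} {H : Y → ℝ} (hH : IsHolderHomogeneous α γ H) (hγ : 0 < γ)
    {Q : X →L[ℝ] Y} (hQ : ∀ x, x ≠ 0 → Q x ≠ 0) :
    IsHolderHomogeneous α γ fun x => H (Q x) where
  hom x hx t ht := by
    change H (Q (t • x)) = t ^ α • H (Q x)
    rw [map_smul]
    exact hH.hom _ (hQ x hx) t ht
  pos x hx := hH.pos _ (hQ x hx)
  holder x hx := by
    have h1 : (fun u => ‖Q u - Q x‖ ^ γ) =O[𝓝 x] fun u => ‖u - x‖ ^ γ :=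
      IsBigO.rpow hγ.le (Eventually.of_forall fun u => norm_nonneg _)

        (by simpa only [map_sub] using (Q.isBigO_sub (𝓝 x) x).norm_norm)
    exact ((hH.holder _ (hQ x hx)).comp_tendsto Q.continuous.continuousAt).trans h1

end IsHolderHomogeneous

/-! ### Logarithmic time, diagonalization and conclusion -/

theorem tendsto_sub_exp_neg (T : ℝ) :
    Tendsto (fun s => T - Real.exp (-s)) atTop (𝓝[<] T) := by
  refine tendsto_nhdsWithin_iff.2 ⟨?_, Eventually.of_forall fun s => ?_⟩
  · simpa using Real.tendsto_exp_neg_atTop_nhds_zero.const_sub T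
  · exact sub_lt_self T (Real.exp_pos _)

theorem tendsto_neg_log_sub (T : ℝ) :
    Tendsto (fun t => -Real.log (T - t)) (𝓝[<] T) atTop := by
  refine tendsto_neg_atBot_atTop.comp (Real.tendsto_log_nhdsGT_zero.comp ?_)
  refine tendsto_nhdsWithin_iff.2 ⟨?_, ?_⟩
  · have : Tendsto (fun t : ℝ => T - t) (𝓝 T) (𝓝 (T - T)) :=
      (continuous_const.sub continuous_id).tendsto T
    rw [sub_self] at this
    exact this.mono_left nhdsWithin_le_nhds
  · filter_upwards [self_mem_nhdsWithin] with t ht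
    exact sub_pos.2 (mem_Iio.1 ht)

theorem DiagonalizablePosEigenvalues.exists_conj {n : ℕ} {A : Matrix (Fin n) (Fin n) ℝ}
    (hA : DiagonalizablePosEigenvalues A) :
    ∃ (P Q : EuclideanSpace ℝ (Fin n) →L[ℝ] EuclideanSpace ℝ (Fin n)) (Λ : Fin n → ℝ),
      (∀ x, Q (P x) = x) ∧ (∀ x, P (Q x) = x) ∧ (∀ i, 0 < Λ i) ∧
      ∀ x i, P (Matrix.toEuclideanLin A x) i = Λ i * P x i := by
  obtain ⟨S, Λ, hS, hΛ, rfl⟩ := hA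
  have hdet := (Matrix.isUnit_iff_isUnit_det S).1 hS
  refine ⟨Matrix.toEuclideanCLM (𝕜 := ℝ) S, Matrix.toEuclideanCLM (𝕜 := ℝ) S⁻¹, Λ, fun x => ?_,
    fun x => ?_, hΛ, fun x i => ?_⟩
  · rw [← mul_apply_eq_comp, ← map_mul, Matrix.nonsing_inv_mul S hdet, map_one]
    rfl
  · rw [← mul_apply_eq_comp, ← map_mul, Matrix.mul_nonsing_inv S hdet, map_one]
    rfl
  · simp only [Matrix.ofLp_toEuclideanCLM, Matrix.toLpLin_apply]
    rw [Matrix.mulVec_mulVec, Matrix.mul_assoc, Matrix.mul_nonsing_inv_cancel_left _ _ hdet,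
      ← Matrix.mulVec_mulVec, Matrix.mulVec_diagonal]

theorem hasDerivAt_comp_sub_exp_neg {n : ℕ} {y : ℝ → EuclideanSpace ℝ (Fin n)}
    {y' : EuclideanSpace ℝ (Fin n)} {T s : ℝ}
    (P : EuclideanSpace ℝ (Fin n) →L[ℝ] EuclideanSpace ℝ (Fin n))
    (hy : HasDerivAt y y' (T - Real.exp (-s))) (i : Fin n) :
    HasDerivAt (fun s => P (y (T - Real.exp (-s))) i) (Real.exp (-s) * P y' i) s := by
  have h1 : HasDerivAt (fun s => T - Real.exp (-s)) (Real.exp (-s)) s := by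
    simpa using ((hasDerivAt_neg s).exp).const_sub T
  have h2 := hy.scomp s h1
  have h3 := ((EuclideanSpace.proj (𝕜 := ℝ) i).comp P).hasFDerivAt.comp_hasDerivAt s h2
  refine h3.congr_deriv ?_
  simp

theorem mainTheorem7 {n : ℕ} (hn : 1 ≤ n)
    (A : Matrix (Fin n) (Fin n) ℝ) (hA : DiagonalizablePosEigenvalues A)
    (α : ℝ) (hα : 0 < α)
    (H : EuclideanSpace ℝ (Fin n) → ℝ) (hHhom : PosHomogeneous α H)
    (hHpos : ∀ x ∈ Metric.sphere (0 : EuclideanSpace ℝ (Fin n)) 1, 0 < H x)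
    (hHcont : ContinuousOn H (Metric.sphere (0 : EuclideanSpace ℝ (Fin n)) 1))
    (t₀ T : ℝ) (ht₀ : 0 ≤ t₀) (hT : t₀ < T)
    (f y : ℝ → EuclideanSpace ℝ (Fin n))
    (hy : IsBlowupSolution A H f t₀ T y)
    (hf : ContinuousOn f (Ico t₀ T))
    (E₀ : ℝ → ℝ) (hE₀ : ∀ t ∈ Ico t₀ T, 0 ≤ E₀ t)
    (hE₀int : MeasureTheory.IntegrableOn E₀ (Ico t₀ T))
    (hfE : ∀ t ∈ Ico t₀ T, ‖f t‖ ≤ ‖y t‖ ^ (1 + α) * E₀ t)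
    (γ : ℝ) (hγ : 0 < γ) (hγ1 : γ ≤ 1)
    (hHC : HasPropertyHCWith γ H (Metric.sphere (0 : EuclideanSpace ℝ (Fin n)) 1))
    (M p : ℝ) (hM : 0 < M) (hp : 1 + 1 / γ < p)
    (hE₀log : ∀ᶠ t in 𝓝[<] T, E₀ t = M / |Real.log (T - t)| ^ p) :
    0 < γ * (p - 1) - 1 ∧
    ∃ (Λ : ℝ) (ξ : EuclideanSpace ℝ (Fin n)),
      Module.End.HasEigenvector (Matrix.toEuclideanLin A) Λ ξ ∧
      α * Λ * H ξ = 1 ∧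
      (fun t => ‖(T - t) ^ (1 / α) • y t - ξ‖)
        =O[𝓝[<] T] (fun t => |Real.log (T - t)| ^ (-(γ * (p - 1) - 1))) := by
  have hp1 : 1 < p := by have := one_div_pos.2 hγ; linarith
  have hpγ : 0 < γ * (p - 1) - 1 := by
    have := (div_lt_iff₀' hγ).1 (lt_sub_iff_add_lt'.2 hp)
    linarith
  refine ⟨hpγ, ?_⟩
  obtain ⟨P, Q, Λ, hQP, hPQ, hΛ, hPA⟩ := hA.exists_conj
  have hQ0 : ∀ x, x ≠ 0 → Q x ≠ 0 := fun x hx h => hx (by rw [← hPQ x, h, map_zero])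
  have hH := (IsHolderHomogeneous.of_sphere hγ hγ1 hHhom hHpos hHC).comp hγ hQ0
  have hIoo : ∀ᶠ s in atTop, T - Real.exp (-s) ∈ Ioo t₀ T :=
    (tendsto_sub_exp_neg T).eventually (Ioo_mem_nhdsLT hT)
  have hynorm (t : ℝ) : ‖y t‖ ≤ ‖Q‖ * ‖P (y t)‖ := by
    conv_lhs => rw [← hQP (y t)]
    exact Q.le_opNorm _
  obtain ⟨μ, ξ, hξ0, hξ, hμ, hO⟩ := hH.exists_profile_of_diagonal hα hγ hγ1 hp1 hΛ
    -- `‖P‖` bounds `P f` by `f`, `‖Q‖ ^ (1 + α)` comes from `‖y‖ ≤ ‖Q‖ ‖P y‖`, and `M` from `E₀`.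
    (K := ‖P‖ * ‖Q‖ ^ (1 + α) * M)
    (z := fun s => P (y (T - Real.exp (-s)))) (F := fun s i => P (f (T - Real.exp (-s))) i)
    (by
      filter_upwards [hIoo] with s hs h
      refine hy.ne_zero _ (Ioo_subset_Ico_self hs) ?_
      rw [← hQP (y _), h, map_zero])
    (by
      have h1 : Tendsto (fun s => ‖y (T - Real.exp (-s))‖) atTop atTop :=
        hy.tendsto_norm.comp (tendsto_sub_exp_neg T)
      -- Adding `1` gives a positive factor without showing `Q ≠ 0`.
      have h2 : Tendsto (fun s => (‖Q‖ + 1) * ‖P (y (T - Real.exp (-s)))‖) atTop atTop := by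
        refine tendsto_atTop_mono (fun s => (hynorm _).trans ?_) h1
        gcongr
        exact le_add_of_nonneg_right zero_le_one
      exact (tendsto_const_mul_atTop_of_pos (by positivity)).1 h2)
    (by
      filter_upwards [hIoo] with s hs i
      refine (hasDerivAt_comp_sub_exp_neg P (hy.hasDerivAt _ hs) i).congr_deriv ?_
      simp [hPA, hQP])
    (by
      filter_upwards [hIoo, (tendsto_sub_exp_neg T).eventually hE₀log, eventually_gt_atTop 0]
        with s h1 h2 h3 i
      have h4 := hfE _ (Ioo_subset_Ico_self h1)
      rw [h2, sub_sub_cancel, Real.log_exp, abs_neg, abs_of_pos h3, div_eq_mul_inv,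
        ← Real.rpow_neg h3.le] at h4
      have h5 : ‖y (T - Real.exp (-s))‖ ^ (1 + α) ≤
          ‖Q‖ ^ (1 + α) * ‖P (y (T - Real.exp (-s)))‖ ^ (1 + α) := by
        rw [← Real.mul_rpow (norm_nonneg _) (norm_nonneg _)]
        exact Real.rpow_le_rpow (norm_nonneg _) (hynorm _) (by linarith)
      have h6 : 0 ≤ M * s ^ (-p) := by positivity
      calc |P (f (T - Real.exp (-s))) i| ≤ ‖P (f (T - Real.exp (-s)))‖ :=
            PiLp.norm_apply_le (P (f (T - Real.exp (-s)))) i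
        _ ≤ ‖P‖ * ‖f (T - Real.exp (-s))‖ := P.le_opNorm _
        _ ≤ ‖P‖ * (‖Q‖ ^ (1 + α) * ‖P (y (T - Real.exp (-s)))‖ ^ (1 + α) * (M * s ^ (-p))) := by
            gcongr
            exact h4.trans (mul_le_mul_of_nonneg_right h5 h6)
        _ = _ := by ring)
  refine ⟨μ, Q ξ, ⟨Module.End.mem_eigenspace_iff.2 ?_, hQ0 ξ hξ0⟩, hμ, ?_⟩
  · rw [← hQP (Matrix.toEuclideanLin A (Q ξ)), ← map_smul]
    congr 1
    ext i
    rw [hPA, hPQ, hξ, PiLp.smul_apply, smul_eq_mul]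
  -- The exponent `γ (p - 1)` is weakened by one before returning to the variable `t`.
  · have h1 := ((hO.trans (isBigO_rpow_neg_rpow_neg (b := γ * (p - 1) - 1)
      (by linarith))).comp_tendsto (tendsto_neg_log_sub T))
    refine (((Q.isBigO_comp _ _).trans h1).norm_left).congr' ?_ ?_
    · filter_upwards [self_mem_nhdsWithin] with t ht
      have ht' : 0 < T - t := sub_pos.2 ht
      simp only [Function.comp_apply, neg_neg, Real.exp_log ht', sub_sub_cancel, map_sub, map_smul,
        hQP]
      rw [Real.rpow_def_of_pos ht', mul_one_div]
    · filter_upwards [(tendsto_neg_log_sub T).eventually_gt_atTop 0] with t ht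
      rw [Function.comp_apply, ← abs_neg, abs_of_pos ht]
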